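/- Let $m,n$ be nonnegative integers. Write $(a)_k=a(a+1)\cdots(a+k-1)$ (with $(a)_0=1$) for the Pochhammer symbol, and for a nonnegative integer $N$ and $c\ne 0,-1,\dots,-N+1$ put ${}_2F_1(-N,b;c;z)=\sum_{k=0}^{N}\frac{(-N)_k(b)_k}{(c)_k\,k!}z^k$. All powers with non-integer exponent are principal values. (i) Let $\alpha>0$. The Gauss series ${}_2F_1(m+1,-\alpha;n+m+2;w)=\sum_{k\ge0}\frac{(m+1)_k(-\alpha)_k}{(n+m+2)_k\,k!}w^k$ $(|w|<1)$ has a unique analytic continuation to $w\in\mathbb{C}\setminus[1,\infty)$, denoted by the same symbol, and for all $z\in\mathbb{C}\setminus[0,1]$ $$(1-z)^{-n-1}(1-z^{-1})^{-\alpha}\,{}_2F_1(m+1,-\alpha;n+m+2;z^{-1})$$ $$=\frac{(n+1)_{m+1}}{(n+\alpha+1)_{m+1}}\,z^{m+1}(1-z)^{-n-1}(1-z^{-1})^{-\alpha}\,{}_2F_1(-n,m+1;-n-\alpha;1-z)+\frac{(m+1)_{n+1}}{(m+\alpha+1)_{n+1}}\,{}_2F_1(-m,n+1;-m-\alpha;z).$$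 Moreover, each of the three terms (the left-hand side and the two summands on the right) is a holomorphic solution on $\mathbb{C}\setminus[0,1]$ of $$z(1-z)u''(z)-\bigl((n+2)z+m(1-z)+\alpha\bigr)u'(z)+m(n+1)u(z)=0,$$ which is the hypergeometric equation $z(1-z)u''+(c-(a+b+1)z)u'-abu=0$ with $(a,b,c)=(-m,n+1,-m-\alpha)$. (ii) For every $z\in\mathbb{C}\setminus[0,1]$, as $\alpha\downarrow0$ the left-hand side tends to $(1-z)^{-n-1}$, the first summand on the right tends to $z^{m+1}\sum_{k=0}^n\frac{(m+1)_k}{k!}(1-z)^{k-n-1}$, and the second summand tends to $\sum_{k=0}^m\frac{(n+1)_k}{k!}z^k$. Thus the identity tends to $$(1-x)^{-n-1}=\sum_{k=0}^m\frac{(n+1)_k}{k!}x^k+x^{m+1}\sum_{k=0}^n\frac{(m+1)_k}{k!}(1-x)^{k-n-1},$$ which holds for all $x\in\mathbb{C}\setminus\{1\}$, and whose three terms solve the differential equation above with $\alpha=0$ on $\mathbb{C}\setminus[0,1]$. -/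

import Mathlib

open Set Filter Topology

namespace ChaundyBullard

noncomputable section

/-- The Pochhammer symbol `(a)_k = a (a+1) ⋯ (a+k-1)`. -/
def poch (a : ℂ) (k : ℕ) : ℂ := (ascPochhammer ℂ k).eval a

/-- The plane `ℂ ∖ [1,∞)`. -/
def slit : Set ℂ := (Complex.ofReal '' Ici (1 : ℝ))ᶜ

/-- The plane `ℂ ∖ [0,1]`. -/
def cutPlane : Set ℂ := (Complex.ofReal '' Icc (0 : ℝ) 1)ᶜ

/-- `F` is a holomorphic function on `ℂ ∖ [1,∞)` which on the unit disc is the sum of the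
Gauss hypergeometric series with parameters `a, b; c`. -/
def IsContinuation (a b c : ℂ) (F : ℂ → ℂ) : Prop :=
  DifferentiableOn ℂ F slit ∧ ∀ w : ℂ, ‖w‖ < 1 → F w = ordinaryHypergeometric a b c w

/-- The Gauss hypergeometric function `₂F₁(a,b;c;·)` on `ℂ ∖ [1,∞)`: the analytic continuation
of the hypergeometric series (a meaningless function if there is no continuation). -/
def hyp (a b c : ℂ) : ℂ → ℂ := Classical.epsilon (IsContinuation a b c)

/-- The terminating series `₂F₁(-N,b;c;z)`, a polynomial in `z`, for `c ≠ 0,-1,…,-N+1`. -/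
def hypTerm (N : ℕ) (b c z : ℂ) : ℂ :=
  ∑ k ∈ Finset.range (N + 1), poch (-(N : ℂ)) k * poch b k / (poch c k * (k.factorial : ℂ)) * z ^ k

/-- The function `(1-z)^{-n-1} (1-z⁻¹)^{-α} ₂F₁(m+1,-α;n+m+2;z⁻¹)`, with the principal branch of
the power of `1-z⁻¹`. -/
def leftTerm (m n : ℕ) (α : ℝ) (z : ℂ) : ℂ :=
  (1 - z) ^ (-(n : ℤ) - 1) * (1 - z⁻¹) ^ (-(α : ℂ)) *
    hyp ((m : ℂ) + 1) (-(α : ℂ)) ((n : ℂ) + m + 2) z⁻¹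

/-- The function
`(n+1)_{m+1} / (n+α+1)_{m+1} · z^{m+1} (1-z)^{-n-1} (1-z⁻¹)^{-α} ₂F₁(-n,m+1;-n-α;1-z)`. -/
def rightTerm₁ (m n : ℕ) (α : ℝ) (z : ℂ) : ℂ :=
  poch ((n : ℂ) + 1) (m + 1) / poch ((n : ℂ) + α + 1) (m + 1) *
    z ^ (m + 1) * (1 - z) ^ (-(n : ℤ) - 1) * (1 - z⁻¹) ^ (-(α : ℂ)) *
    hypTerm n ((m : ℂ) + 1) (-(n : ℂ) - α) (1 - z)

/-- The function `(m+1)_{n+1} / (m+α+1)_{n+1} · ₂F₁(-m,n+1;-m-α;z)`. -/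
def rightTerm₂ (m n : ℕ) (α : ℝ) (z : ℂ) : ℂ :=
  poch ((m : ℂ) + 1) (n + 1) / poch ((m : ℂ) + α + 1) (n + 1) *
    hypTerm m ((n : ℂ) + 1) (-(m : ℂ) - α) z

/-- The function `(1-x)^{-n-1}`. -/
def leftTerm₀ (n : ℕ) (x : ℂ) : ℂ := (1 - x) ^ (-(n : ℤ) - 1)

/-- The function `x^{m+1} ∑_{k=0}^n (m+1)_k / k! · (1-x)^{k-n-1}`. -/
def rightTerm₁₀ (m n : ℕ) (x : ℂ) : ℂ :=
  x ^ (m + 1) * ∑ k ∈ Finset.range (n + 1),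
    poch ((m : ℂ) + 1) k / (k.factorial : ℂ) * (1 - x) ^ ((k : ℤ) - n - 1)

/-- The function `∑_{k=0}^m (n+1)_k / k! · x^k`. -/
def rightTerm₂₀ (m n : ℕ) (x : ℂ) : ℂ :=
  ∑ k ∈ Finset.range (m + 1), poch ((n : ℂ) + 1) k / (k.factorial : ℂ) * x ^ k

/-- `u` is holomorphic on the open set `U` and there solves
`z(1-z)u'' - ((n+2)z + m(1-z) + α)u' + m(n+1)u = 0`, the hypergeometric differential equation
`z(1-z)u'' + (c-(a+b+1)z)u' - abu = 0` for `(a,b,c) = (-m,n+1,-m-α)`. -/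
def SolvesODE (m n : ℕ) (α : ℝ) (U : Set ℂ) (u : ℂ → ℂ) : Prop :=
  DifferentiableOn ℂ u U ∧ ∀ z ∈ U,
    z * (1 - z) * deriv (deriv u) z
      - (((n : ℂ) + 2) * z + m * (1 - z) + α) * deriv u z + m * ((n : ℂ) + 1) * u z = 0

end

end ChaundyBullard

open ChaundyBullard

namespace ChaundyBullard

noncomputable section

/-! Put `G_n(w) = w^(m+n+1) ₂F₁(m+1,-α;n+m+2;w)`. Differentiating the series gives `G_(n+1)' =
(n+m+2) G_n`, and `G_0' = (m+1) w^m (1-w)^α` is a binomial series. So `G_n` is an iterated primitive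
vanishing at `0`. The elementary function `numer`, a polynomial plus `(1-w)^(α+n+1)` times a
polynomial, obeys the same recursion (`hasDerivAt_numer_zero`, `hasDerivAt_numer_succ`) and vanishes
at `0` (`numer_apply_zero`). Termwise integration (`hasSum_primitive`) then gives `numer = G_n` on
the unit disc. As `numer` is holomorphic off `[1,∞)`, the quotient `numer / w^(m+n+1)` is the
continuation, unique because the slit plane is connected. At `w = z⁻¹` the two summands of `numer`
become the two terms on the right of the identity. The right-hand terms satisfy the differential
equation by direct computation, and the left-hand term does so as their sum. All of this holds for
`α ≥ 0`: the case `α = 0` is the limit identity, the right-hand terms are continuous in `α` at `0`,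
and the limit of the left-hand term follows from the identity. -/

/-! ### Pochhammer symbols -/

lemma poch_zero (a : ℂ) : poch a 0 = 1 := by simp [poch]

lemma poch_succ (a : ℂ) (k : ℕ) : poch a (k + 1) = poch a k * (a + k) := by
  simp [poch, ascPochhammer_succ_eval]

/-- Both sides are `(a)_(k+1)`. This is the tool for every unit shift of a parameter below. -/
lemma mul_poch_add_one (a : ℂ) (k : ℕ) : a * poch (a + 1) k = poch a k * (a + k) := by
  induction k with
  | zero => simp [poch_zero]
  | succ k ih =>
    rw [poch_succ, poch_succ, ← mul_assoc, ih]
    push_cast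
    ring

lemma poch_add (a : ℂ) (j k : ℕ) : poch a (j + k) = poch a j * poch (a + j) k := by
  induction k with
  | zero => simp [poch_zero]
  | succ k ih =>
    rw [← add_assoc, poch_succ, poch_succ, ih]
    push_cast
    ring

lemma poch_one (k : ℕ) : poch 1 k = (k.factorial : ℂ) := by
  induction k with
  | zero => simp [poch_zero]
  | succ k ih =>
    rw [poch_succ, ih, Nat.factorial_succ]
    push_cast
    ring

lemma poch_ne_zero {a : ℂ} {k : ℕ} (h : ∀ j < k, a + j ≠ 0) : poch a k ≠ 0 := by
  induction k with
  | zero => simp [poch_zero]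
  | succ k ih =>
    rw [poch_succ]
    exact mul_ne_zero (ih fun j hj => h j (by omega)) (h k (by omega))

/-- Up to sign, the factors on the left are those of `(a+1)_N` in reverse order. -/
lemma poch_neg_sub (N : ℕ) (a : ℂ) : poch (-(N : ℂ) - a) N = (-1) ^ N * poch (a + 1) N := by
  induction N with
  | zero => simp [poch_zero]
  | succ N ih =>
    have h := mul_poch_add_one (-((N + 1 : ℕ) : ℂ) - a) N
    rw [show -((N + 1 : ℕ) : ℂ) - a + 1 = -(N : ℂ) - a by push_cast; ring, ih] at h
    rw [poch_succ, ← h, poch_succ]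
    push_cast
    ring

lemma poch_neg_self (N : ℕ) : poch (-(N : ℂ)) N = (-1) ^ N * (N.factorial : ℂ) := by
  simpa [poch_one] using poch_neg_sub N 0

lemma poch_neg_eq_zero {N k : ℕ} (h : N < k) : poch (-(N : ℂ)) k = 0 := by
  induction k, h using Nat.le_induction with
  | base => rw [poch_succ]; simp
  | succ k _ ih => rw [poch_succ, ih, zero_mul]

lemma natCast_add_ofReal_ne_zero {α : ℝ} (hα : 0 ≤ α) {k : ℕ} (hk : 0 < k) :
    (k : ℂ) + α ≠ 0 := by
  have : (0 : ℝ) < k + α := by positivity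
  exact_mod_cast this.ne'

lemma natCast_add_ofReal_sub_ne_zero {α : ℝ} (hα : 0 ≤ α) {N k : ℕ} (hk : k < N) :
    (N : ℂ) + α - k ≠ 0 := by
  have := natCast_add_ofReal_ne_zero hα (Nat.sub_pos_of_lt hk)
  rw [Nat.cast_sub hk.le] at this
  convert this using 1
  ring

lemma poch_neg_sub_ne_zero {α : ℝ} (hα : 0 ≤ α) {N k : ℕ} (hk : k ≤ N) :
    poch (-(N : ℂ) - α) k ≠ 0 := by
  refine poch_ne_zero fun j hj h => ?_
  apply natCast_add_ofReal_sub_ne_zero hα (show j < N by omega)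
  linear_combination -h

lemma poch_add_one_ne_zero {α : ℝ} (hα : 0 ≤ α) (n k : ℕ) : poch ((n : ℂ) + α + 1) k ≠ 0 := by
  refine poch_ne_zero fun j hj h => ?_
  apply natCast_add_ofReal_ne_zero hα (show 0 < n + 1 + j by omega)
  push_cast
  linear_combination h

/-! ### Coefficients of the terminating series and their recurrences -/

/-- The coefficient of `z ^ k` in the terminating series `₂F₁(-N,b;-N-α;z)`. -/
def termCoeff (N : ℕ) (b : ℂ) (α : ℝ) (k : ℕ) : ℂ :=
  poch (-(N : ℂ)) k * poch b k / (poch (-(N : ℂ) - α) k * (k.factorial : ℂ))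

lemma hypTerm_eq_sum (N : ℕ) (b : ℂ) (α : ℝ) (z : ℂ) :
    hypTerm N b (-(N : ℂ) - α) z = ∑ k ∈ Finset.range (N + 1), termCoeff N b α k * z ^ k := rfl

lemma termCoeff_zero (N : ℕ) (b : ℂ) (α : ℝ) : termCoeff N b α 0 = 1 := by
  simp [termCoeff, poch_zero]

lemma termCoeff_of_lt {N k : ℕ} (h : N < k) (b : ℂ) (α : ℝ) : termCoeff N b α k = 0 := by
  simp [termCoeff, poch_neg_eq_zero h]

/-- Cleared of denominators, the ratio of consecutive coefficients holds for every `k`: at `k = N`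
the factor `N - k` vanishes, and beyond it both coefficients do. -/
lemma termCoeff_succ {α : ℝ} (hα : 0 ≤ α) (N : ℕ) (b : ℂ) (k : ℕ) :
    ((k : ℂ) + 1) * (N + α - k) * termCoeff N b α (k + 1)
      = (N - k) * (b + k) * termCoeff N b α k := by
  rcases lt_trichotomy k N with h | rfl | h
  · have h1 := poch_neg_sub_ne_zero hα h.le
    have h2 := natCast_add_ofReal_sub_ne_zero hα h
    have h3 : (k.factorial : ℂ) ≠ 0 := by exact_mod_cast k.factorial_ne_zero
    have h4 : (k : ℂ) + 1 ≠ 0 := by exact_mod_cast k.succ_ne_zero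
    have h5 : -(N : ℂ) - α + k ≠ 0 := fun h => h2 (by linear_combination -h)
    simp only [termCoeff, poch_succ, Nat.factorial_succ]
    push_cast
    field_simp
    ring
  · rw [termCoeff_of_lt (Nat.lt_succ_self k)]
    ring
  · rw [termCoeff_of_lt h, termCoeff_of_lt (h.trans (Nat.lt_succ_self k))]
    ring

lemma termCoeff_succ_left {α : ℝ} (hα : 0 ≤ α) (N : ℕ) (b : ℂ) {k : ℕ} (hk : k ≤ N) :
    termCoeff (N + 1) b α k * ((N + 1 - k) * (N + 1 + α))
      = termCoeff N b α k * ((N + 1) * (N + 1 + α - k)) := by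
  have h1 := poch_neg_sub_ne_zero hα hk
  have h2 := poch_neg_sub_ne_zero hα (hk.trans N.le_succ)
  have h3 : (k.factorial : ℂ) ≠ 0 := by exact_mod_cast k.factorial_ne_zero
  have e1 := mul_poch_add_one (-((N + 1 : ℕ) : ℂ)) k
  have e2 := mul_poch_add_one (-((N + 1 : ℕ) : ℂ) - α) k
  rw [show -((N + 1 : ℕ) : ℂ) + 1 = -(N : ℂ) by push_cast; ring] at e1
  rw [show -((N + 1 : ℕ) : ℂ) - α + 1 = -(N : ℂ) - α by push_cast; ring] at e2
  simp only [termCoeff]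
  rw [div_mul_eq_mul_div, div_mul_eq_mul_div, div_eq_div_iff (by positivity) (by positivity)]
  push_cast at *
  linear_combination ((k.factorial : ℂ) * poch b k) * ((-(N + 1) + (k : ℂ)) * poch (-(N + 1)) k * e2
    - poch (-(N + 1) - α) k * (-(N + 1 : ℂ) - α + k) * e1)

lemma termCoeff_add_one_right (N : ℕ) (b : ℂ) (α : ℝ) (k : ℕ) :
    b * termCoeff N (b + 1) α k = (b + k) * termCoeff N b α k := by
  simp only [termCoeff]
  linear_combination (poch (-(N : ℂ)) k / (poch (-(N : ℂ) - α) k * (k.factorial : ℂ))) *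
    mul_poch_add_one b k

/-- The coefficient `(n+1)_{m+1} / (n+α+1)_{m+1}`. -/
def connCoeff (n m : ℕ) (α : ℝ) : ℂ :=
  poch ((n : ℂ) + 1) (m + 1) / poch ((n : ℂ) + α + 1) (m + 1)

/-- With `connCoeff_succ_right`, this matches the constants produced by differentiating the two
summands of `numer`. -/
lemma connCoeff_succ_left {α : ℝ} (hα : 0 ≤ α) (n m : ℕ) :
    connCoeff (n + 1) m α * ((n + 1) * (n + 1 + α + m + 1))
      = connCoeff n m α * ((n + m + 2) * (n + 1 + α)) := by
  have h1 := poch_add_one_ne_zero hα n (m + 1)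
  have h2 := poch_add_one_ne_zero hα (n + 1) (m + 1)
  have e1 := mul_poch_add_one ((n : ℂ) + 1) (m + 1)
  have e2 := mul_poch_add_one ((n : ℂ) + α + 1) (m + 1)
  rw [show (n : ℂ) + α + 1 + 1 = ((n + 1 : ℕ) : ℂ) + α + 1 by push_cast; ring] at e2
  simp only [connCoeff]
  rw [div_mul_eq_mul_div, div_mul_eq_mul_div, div_eq_div_iff h2 h1]
  push_cast at *
  linear_combination ((n : ℂ) + 1 + α + m + 1) * poch ((n : ℂ) + α + 1) (m + 1) * e1
    - ((n : ℂ) + m + 2) * poch ((n : ℂ) + 1) (m + 1) * e2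

lemma connCoeff_succ_right {α : ℝ} (hα : 0 ≤ α) (n m : ℕ) :
    connCoeff n (m + 1) α * (n + m + 2 + α) = connCoeff n m α * (n + m + 2) := by
  have h1 := poch_add_one_ne_zero hα n (m + 1)
  have h2 := poch_add_one_ne_zero hα n (m + 2)
  simp only [connCoeff]
  rw [div_mul_eq_mul_div, div_mul_eq_mul_div, div_eq_div_iff h2 h1,
    poch_succ _ (m + 1), poch_succ _ (m + 1)]
  push_cast
  ring

/-- The closed form is symmetric in `n` and `m`, which is what makes the two summands of `numer`
cancel at `0`. -/
lemma connCoeff_mul_termCoeff_self {α : ℝ} (hα : 0 ≤ α) (n m : ℕ) :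
    connCoeff n m α * termCoeff n (m + 1) α n
      = poch 1 (n + m + 1) * poch 1 (n + m) /
        (poch 1 n * poch 1 m * poch ((α : ℂ) + 1) (n + m + 1)) := by
  have h1 := poch_add_one_ne_zero hα n (m + 1)
  have h2 : poch ((α : ℂ) + 1) n ≠ 0 := by simpa using poch_add_one_ne_zero hα 0 n
  have h3 : (n.factorial : ℂ) ≠ 0 := by exact_mod_cast n.factorial_ne_zero
  have h4 : (m.factorial : ℂ) ≠ 0 := by exact_mod_cast m.factorial_ne_zero
  have e1 := poch_add 1 n (m + 1)
  have e2 := poch_add 1 m n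
  have e3 := poch_add ((α : ℂ) + 1) n (m + 1)
  rw [show (α : ℂ) + 1 + n = n + α + 1 by ring] at e3
  rw [← add_assoc, add_comm (1 : ℂ) (n : ℂ)] at e1
  rw [add_comm (1 : ℂ) (m : ℂ), add_comm m n] at e2
  rw [← add_assoc] at e3
  rw [e1, e2, e3, connCoeff, termCoeff, poch_neg_sub, poch_neg_self, poch_one, poch_one]
  field_simp

lemma connCoeff_mul_termCoeff_self_comm {α : ℝ} (hα : 0 ≤ α) (n m : ℕ) :
    connCoeff n m α * termCoeff n (m + 1) α n = connCoeff m n α * termCoeff m (n + 1) α m := by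
  rw [connCoeff_mul_termCoeff_self hα, connCoeff_mul_termCoeff_self hα, add_comm m n,
    mul_comm (poch 1 m)]

lemma termCoeff_succ_of_add_one {α : ℝ} (hα : 0 ≤ α) (N : ℕ) (b : ℂ) (k : ℕ) :
    ((k : ℂ) + 1) * (N + α - k) * termCoeff N b α (k + 1)
      = (N - k) * b * termCoeff N (b + 1) α k := by
  linear_combination termCoeff_succ hα N b k - ((N : ℂ) - k) * termCoeff_add_one_right N b α k

/-! ### Reversed polynomials and their derivatives -/

/-- The polynomial `w ^ n · ₂F₁(-n,b;-n-α;1-w⁻¹)` in `w`. -/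
def revTermOneSub (n : ℕ) (b : ℂ) (α : ℝ) (w : ℂ) : ℂ :=
  ∑ k ∈ Finset.range (n + 1), termCoeff n b α k * (w ^ (n - k) * (w - 1) ^ k)

/-- The polynomial `w ^ m · ₂F₁(-m,b;-m-α;w⁻¹)` in `w`. -/
def revTerm (m : ℕ) (b : ℂ) (α : ℝ) (w : ℂ) : ℂ :=
  ∑ k ∈ Finset.range (m + 1), termCoeff m b α k * w ^ (m - k)

lemma revTerm_zero_right (m : ℕ) (α : ℝ) (w : ℂ) : revTerm m 0 α w = w ^ m := by
  rw [revTerm, Finset.sum_range_succ', Finset.sum_eq_zero, termCoeff_zero]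
  · simp
  · intro k _
    have : poch 0 (k + 1) = 0 := by simp [poch]
    simp [termCoeff, this]

lemma hasDerivAt_revTermOneSub {α : ℝ} (hα : 0 ≤ α) (n m : ℕ) (w : ℂ) :
    HasDerivAt (revTermOneSub (n + 1) (m + 1) α)
      ((n + 1) * (n + 1 + α + m + 1) / (n + 1 + α) * revTermOneSub n (m + 1) α w) w := by
  have hd : HasDerivAt (revTermOneSub (n + 1) (m + 1) α)
      (∑ k ∈ Finset.range (n + 1 + 1), termCoeff (n + 1) (m + 1) α k *
        (((n + 1 - k : ℕ) : ℂ) * w ^ (n + 1 - k - 1) * (w - 1) ^ k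
          + w ^ (n + 1 - k) * ((k : ℂ) * (w - 1) ^ (k - 1)))) w := by
    refine HasDerivAt.fun_sum fun k _ => HasDerivAt.const_mul _ (HasDerivAt.fun_mul ?_ ?_)
    · exact hasDerivAt_pow _ _
    · simpa using ((hasDerivAt_id w).sub_const 1).fun_pow k
  refine hd.congr_deriv (Eq.symm ?_)
  have h0 : (n : ℂ) + 1 + α ≠ 0 := by
    exact_mod_cast natCast_add_ofReal_ne_zero hα n.succ_pos
  simp only [mul_add, Finset.sum_add_distrib]
  rw [Finset.sum_range_succ _ (n + 1), Finset.sum_range_succ' _ (n + 1), revTermOneSub,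
    Finset.mul_sum]
  simp only [Nat.sub_self, Nat.cast_zero, zero_mul, mul_zero, add_zero]
  rw [← Finset.sum_add_distrib]
  refine Finset.sum_congr rfl fun k hk => ?_
  have hk' : k ≤ n := by simpa [Nat.lt_succ_iff] using hk
  have e1 := termCoeff_succ hα (n + 1) (m + 1) k
  have e2 := termCoeff_succ_left hα n (m + 1) hk'
  have h2 := natCast_add_ofReal_sub_ne_zero hα (show k < n + 1 by omega)
  rw [show n + 1 - k - 1 = n - k by omega, show n + 1 - (k + 1) = n - k by omega,
    Nat.cast_sub (by omega)]
  push_cast at *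
  -- The coefficient of `w^(n-k) (w-1)^k` collects the derivative of the power of `w` in term `k`
  -- and of the power of `w-1` in term `k+1`.
  have key : (n + 1) * (n + 1 + α + m + 1) / (n + 1 + α) * termCoeff n (m + 1) α k
      = termCoeff (n + 1) (m + 1) α k * ((n : ℂ) + 1 - k)
        + termCoeff (n + 1) (m + 1) α (k + 1) * (k + 1) := by
    rw [div_mul_eq_mul_div, div_eq_iff h0]
    apply mul_right_cancel₀ h2
    linear_combination (-(n + 1 + α + m + 1 : ℂ)) * e2 - (n + 1 + α : ℂ) * e1
  linear_combination (w ^ (n - k) * (w - 1) ^ k) * key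

lemma hasDerivAt_revTerm (m : ℕ) (b : ℂ) (α : ℝ) (w : ℂ) :
    HasDerivAt (revTerm m b α) (∑ k ∈ Finset.range (m + 1),
      termCoeff m b α k * (((m - k : ℕ) : ℂ) * w ^ (m - k - 1))) w :=
  HasDerivAt.fun_sum fun _ _ => HasDerivAt.const_mul _ (hasDerivAt_pow _ _)

/-- Stripped of its factor `(1-w)^(α+b)`, this is the derivative of `(1-w)^(α+b+1) revTerm m (b+1) α
w`: differentiation lowers `b + 1` to `b`. -/
lemma one_sub_mul_deriv_revTerm {α : ℝ} (hα : 0 ≤ α) (m : ℕ) (b w : ℂ) :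
    (1 - w) * (∑ k ∈ Finset.range (m + 1),
      termCoeff m (b + 1) α k * (((m - k : ℕ) : ℂ) * w ^ (m - k - 1)))
        - (α + b + 1) * revTerm m (b + 1) α w
      = -(m + α + b + 1) * revTerm m b α w := by
  have h1 : w * (∑ k ∈ Finset.range (m + 1),
      termCoeff m (b + 1) α k * (((m - k : ℕ) : ℂ) * w ^ (m - k - 1)))
        + (α + b + 1) * revTerm m (b + 1) α w
      = ∑ k ∈ Finset.range (m + 1),
        termCoeff m (b + 1) α k * (m - k + α + b + 1) * w ^ (m - k) := by
    rw [revTerm, Finset.mul_sum, Finset.mul_sum, ← Finset.sum_add_distrib]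
    refine Finset.sum_congr rfl fun k hk => ?_
    have hk' : k ≤ m := by simpa [Nat.lt_succ_iff] using hk
    rcases hk'.eq_or_lt with rfl | h
    · simp
      ring
    · obtain ⟨j, rfl⟩ := Nat.exists_eq_add_of_lt h
      rw [show k + j + 1 - k = j + 1 by omega]
      push_cast
      ring
  have h2 : (∑ k ∈ Finset.range (m + 1),
      termCoeff m (b + 1) α k * (((m - k : ℕ) : ℂ) * w ^ (m - k - 1)))
      = ∑ k ∈ Finset.range m, termCoeff m (b + 1) α k * (m - k) * w ^ (m - (k + 1)) := by
    rw [Finset.sum_range_succ]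
    simp only [Nat.sub_self, Nat.cast_zero, zero_mul, mul_zero, add_zero]
    refine Finset.sum_congr rfl fun k hk => ?_
    rw [Nat.cast_sub (Finset.mem_range.1 hk).le, Nat.sub_sub]
    ring
  suffices h : ∑ k ∈ Finset.range m, termCoeff m (b + 1) α k * (m - k) * w ^ (m - (k + 1))
      - ∑ k ∈ Finset.range (m + 1),
        termCoeff m (b + 1) α k * (m - k + α + b + 1) * w ^ (m - k)
      = -(m + α + b + 1) * revTerm m b α w by
    rw [← h, ← h1, ← h2]
    ring
  rw [revTerm, Finset.sum_range_succ', Finset.sum_range_succ', ← sub_sub,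
    ← Finset.sum_sub_distrib, mul_add (-(m + α + b + 1 : ℂ)), Finset.mul_sum, sub_eq_add_neg]
  congr 1
  · refine Finset.sum_congr rfl fun k hk => ?_
    have h3 := natCast_add_ofReal_sub_ne_zero hα (Finset.mem_range.1 hk)
    have h4 : (k : ℂ) + 1 ≠ 0 := by exact_mod_cast k.succ_ne_zero
    have e1 := termCoeff_succ hα m (b + 1) k
    have e2 := termCoeff_succ_of_add_one hα m b k
    -- Comparison of the coefficients of `w^(m-(k+1))`. Both `termCoeff m (b+1) α (k+1)` and
    -- `termCoeff m b α (k+1)` are multiples of `termCoeff m (b+1) α k`.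
    have key : termCoeff m (b + 1) α k * (m - k)
        - termCoeff m (b + 1) α (k + 1) * (m - (k + 1) + α + b + 1)
        = -(m + α + b + 1) * termCoeff m b α (k + 1) := by
      apply mul_left_cancel₀ (mul_ne_zero h4 h3)
      linear_combination (-(m - (k + 1) + α + b + 1 : ℂ)) * e1 + (m + α + b + 1 : ℂ) * e2
    push_cast
    linear_combination w ^ (m - (k + 1)) * key
  · simp only [termCoeff_zero]
    push_cast
    ring

lemma hasDerivAt_one_sub_cpow_mul_pow {a w : ℂ} (hw : 1 - w ∈ Complex.slitPlane) (n : ℕ) :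
    HasDerivAt (fun w => (1 - w) ^ a * (1 - w) ^ (n + 1))
      (-(a + n + 1) * ((1 - w) ^ a * (1 - w) ^ n)) w := by
  have h1 : HasDerivAt (fun w : ℂ => 1 - w) (-1) w := by
    simpa using (hasDerivAt_id w).const_sub 1
  have h2 := (h1.cpow_const (c := a) hw).fun_mul (h1.fun_pow (n + 1))
  refine h2.congr_deriv (Eq.symm ?_)
  have h3 : (1 - w) ^ a = (1 - w) ^ (a - 1) * (1 - w) := by
    rw [Complex.cpow_sub _ _ (Complex.slitPlane_ne_zero hw), Complex.cpow_one,
      div_mul_cancel₀ _ (Complex.slitPlane_ne_zero hw)]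
  simp only [Nat.add_sub_cancel, pow_succ]
  push_cast
  linear_combination (a * (1 - w) ^ n * (-1)) * h3

/-! ### The elementary form of the Gauss function -/

/-- The function `w ^ (m+n+1) · ₂F₁(m+1,-α;n+m+2;w)` in elementary form. -/
def numer (m n : ℕ) (α : ℝ) (w : ℂ) : ℂ :=
  connCoeff n m α * revTermOneSub n (m + 1) α w
    + (-1) ^ (n + 1) * connCoeff m n α *
      ((1 - w) ^ (α : ℂ) * (1 - w) ^ (n + 1) * revTerm m (n + 1) α w)

lemma hasDerivAt_numer_aux {α : ℝ} (hα : 0 ≤ α) (m n : ℕ) {w : ℂ}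
    (hw : 1 - w ∈ Complex.slitPlane) :
    HasDerivAt (fun w => (1 - w) ^ (α : ℂ) * (1 - w) ^ (n + 1) * revTerm m (n + 1) α w)
      (-(m + α + n + 1) * ((1 - w) ^ (α : ℂ) * (1 - w) ^ n * revTerm m n α w)) w := by
  refine ((hasDerivAt_one_sub_cpow_mul_pow (a := α) hw n).fun_mul
    (hasDerivAt_revTerm m (n + 1) α w)).congr_deriv (Eq.symm ?_)
  have := one_sub_mul_deriv_revTerm hα m n w
  rw [pow_succ]
  linear_combination (-((1 - w) ^ (α : ℂ) * (1 - w) ^ n)) * this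

lemma hasDerivAt_numer_zero {α : ℝ} (hα : 0 ≤ α) (m : ℕ) {w : ℂ}
    (hw : 1 - w ∈ Complex.slitPlane) :
    HasDerivAt (numer m 0 α) ((m + 1) * (w ^ m * (1 - w) ^ (α : ℂ))) w := by
  have h1 : HasDerivAt (fun w => connCoeff 0 m α * revTermOneSub 0 (m + 1) α w) 0 w := by
    simpa [revTermOneSub] using hasDerivAt_const w _
  refine (h1.fun_add ((hasDerivAt_numer_aux hα m 0 hw).const_mul
    ((-1) ^ (0 + 1) * connCoeff m 0 α))).congr_deriv (Eq.symm ?_)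
  have h2 : connCoeff m 0 α * (m + α + 1) = m + 1 := by
    have := poch_add_one_ne_zero hα m 1
    simp only [connCoeff, zero_add]
    rw [poch_succ, poch_succ, poch_zero, poch_zero] at *
    simp only [Nat.cast_zero, add_zero, one_mul] at *
    exact div_mul_cancel₀ _ this
  rw [Nat.cast_zero, revTerm_zero_right]
  linear_combination (-(w ^ m * (1 - w) ^ (α : ℂ))) * h2

/-- This is the elementary counterpart of `(w^(c-1) F(a,b;c;w))' = (c-1) w^(c-2) F(a,b;c-1;w)` at `c
= n+m+3`. -/
lemma hasDerivAt_numer_succ {α : ℝ} (hα : 0 ≤ α) (m n : ℕ) {w : ℂ}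
    (hw : 1 - w ∈ Complex.slitPlane) :
    HasDerivAt (numer m (n + 1) α) ((n + m + 2) * numer m n α w) w := by
  refine (((hasDerivAt_revTermOneSub hα n m w).const_mul (connCoeff (n + 1) m α)).fun_add
    (((hasDerivAt_numer_aux hα m (n + 1) hw).const_mul
    ((-1) ^ (n + 1 + 1) * connCoeff m (n + 1) α)))).congr_deriv (Eq.symm ?_)
  have h0 : (n : ℂ) + 1 + α ≠ 0 := by
    exact_mod_cast natCast_add_ofReal_ne_zero hα n.succ_pos
  have e1 : connCoeff (n + 1) m α * ((n + 1) * (n + 1 + α + m + 1) / (n + 1 + α))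
      = connCoeff n m α * (n + m + 2) := by
    rw [← mul_div_assoc, connCoeff_succ_left hα, ← mul_assoc, mul_div_cancel_right₀ _ h0]
  have e2 := connCoeff_succ_right hα m n
  rw [numer]
  push_cast
  linear_combination (-revTermOneSub n (m + 1) α w) * e1
    - (-1) ^ (n + 1) * ((1 - w) ^ (α : ℂ) * (1 - w) ^ (n + 1) * revTerm m (n + 1) α w) * e2

/-- At `w = 0` only the last term of each polynomial survives; these agree by the symmetry in `n`
and `m` and carry opposite signs. -/
lemma numer_apply_zero {α : ℝ} (hα : 0 ≤ α) (m n : ℕ) : numer m n α 0 = 0 := by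
  have h1 : revTermOneSub n (m + 1) α 0 = termCoeff n (m + 1) α n * (-1) ^ n := by
    rw [revTermOneSub, Finset.sum_range_succ, Finset.sum_eq_zero]
    · simp
    · intro k hk
      rw [zero_pow (Nat.sub_ne_zero_of_lt (Finset.mem_range.1 hk))]
      ring
  have h2 : revTerm m (n + 1) α 0 = termCoeff m (n + 1) α m := by
    rw [revTerm, Finset.sum_range_succ, Finset.sum_eq_zero]
    · simp
    · intro k hk
      rw [zero_pow (Nat.sub_ne_zero_of_lt (Finset.mem_range.1 hk))]
      ring
  rw [numer, h1, h2]
  simp only [sub_zero, Complex.one_cpow, one_pow, one_mul]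
  linear_combination (-1) ^ n * connCoeff_mul_termCoeff_self_comm hα n m

/-! ### Termwise integration of power series -/

lemma hasSum_primitive {f g : ℂ → ℂ} {b : ℕ → ℂ} {s : ℕ}
    (hf : ∀ w : ℂ, ‖w‖ < 1 → HasDerivAt f (g w) w) (h0 : f 0 = 0)
    (hg : ∀ w : ℂ, ‖w‖ < 1 → HasSum (fun k => b k * w ^ (s + k)) (g w)) {w : ℂ} (hw : ‖w‖ < 1) :
    HasSum (fun k => b k / (s + k + 1) * w ^ (s + 1 + k)) (f w) := by
  obtain ⟨r, hwr, hr⟩ := exists_between hw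
  have hr0 : 0 < r := (norm_nonneg w).trans_lt hwr
  have hrn : ‖(r : ℂ)‖ = r := by simp [abs_of_pos hr0]
  -- Absolute convergence at the radius `r` dominates the differentiated series on the ball, so the
  -- integrated series may be differentiated termwise.
  have hu : Summable fun k => ‖b k * (r : ℂ) ^ (s + k)‖ :=
    (hg r (by rwa [hrn])).summable.norm
  set F : ℕ → ℂ → ℂ := fun k w => b k / (s + k + 1) * w ^ (s + 1 + k) with hF
  have hd : ∀ k y, y ∈ Metric.ball (0 : ℂ) r → HasDerivAt (F k) (b k * y ^ (s + k)) y := by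
    intro k y _
    have hk : (s : ℂ) + k + 1 ≠ 0 := by exact_mod_cast (s + k).succ_ne_zero
    refine ((hasDerivAt_pow (s + 1 + k) y).const_mul (b k / (s + k + 1))).congr_deriv ?_
    rw [show s + 1 + k - 1 = s + k by omega]
    push_cast
    field_simp
    ring
  have hbd : ∀ k y, y ∈ Metric.ball (0 : ℂ) r →
      ‖b k * y ^ (s + k)‖ ≤ ‖b k * (r : ℂ) ^ (s + k)‖ := by
    intro k y hy
    rw [norm_mul, norm_mul, norm_pow, norm_pow, hrn]
    gcongr
    simpa using (mem_ball_zero_iff.1 hy).le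
  have h00 : (0 : ℂ) ∈ Metric.ball (0 : ℂ) r := by simpa using hr0
  have hF0 : ∀ k, F k 0 = 0 := by
    intro k
    simp [hF]
  have hs0 : Summable fun k => F k 0 := by simp [hF0]
  have hwb : w ∈ Metric.ball (0 : ℂ) r := by simpa using hwr
  have hpre : IsPreconnected (Metric.ball (0 : ℂ) r) := (convex_ball _ _).isPreconnected
  have hsum : Summable fun k => F k w :=
    summable_of_summable_hasDerivAt_of_isPreconnected hu Metric.isOpen_ball hpre hd hbd h00 hs0 hwb
  have hder : ∀ y ∈ Metric.ball (0 : ℂ) r, HasDerivAt (fun z => ∑' k, F k z) (g y) y := by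
    intro y hy
    have := hasDerivAt_tsum_of_isPreconnected hu Metric.isOpen_ball hpre hd hbd h00 hs0 hy
    rwa [(hg y ((mem_ball_zero_iff.1 hy).trans hr)).tsum_eq] at this
  have heq : EqOn f (fun z => ∑' k, F k z) (Metric.ball (0 : ℂ) r) := by
    refine Metric.isOpen_ball.eqOn_of_deriv_eq hpre
      (fun y hy => (hf y ((mem_ball_zero_iff.1 hy).trans hr)).differentiableAt.differentiableWithinAt)
      (fun y hy => (hder y hy).differentiableAt.differentiableWithinAt)
      (fun y hy => ?_) h00 ?_
    · rw [(hf y ((mem_ball_zero_iff.1 hy).trans hr)).deriv, (hder y hy).deriv]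
    · simp [hF0, h0]
  rw [heq hwb]
  exact hsum.hasSum

lemma hasSum_one_sub_cpow (a : ℂ) {w : ℂ} (hw : ‖w‖ < 1) :
    HasSum (fun k => poch (-a) k / (k.factorial : ℂ) * w ^ k) ((1 - w) ^ a) := by
  have h := (Complex.one_div_one_sub_cpow_hasFPowerSeriesOnBall_zero (-a)).hasSum
    (y := w) (by simpa [← ENNReal.ofReal_one, Metric.eball_ofReal] using hw)
  rw [zero_add, Complex.cpow_neg, one_div, inv_inv] at h
  have hf : (fun k => poch (-a) k / (k.factorial : ℂ) * w ^ k) = fun k : ℕ =>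
      FormalMultilinearSeries.ofScalars ℂ (fun n : ℕ => Ring.choose (-a + n - 1) n) k
        fun _ => w := by
    funext k
    have h0 : (k.factorial : ℂ) ≠ 0 := by exact_mod_cast k.factorial_ne_zero
    -- `Ring.choose x k` is `multichoose (x-k+1) k`, and `x = -a+k-1` makes the first argument `-a`.
    have e := Ring.factorial_nsmul_multichoose_eq_ascPochhammer (-a) k
    rw [Polynomial.ascPochhammer_smeval_eq_eval, nsmul_eq_mul] at e
    rw [FormalMultilinearSeries.ofScalars_apply_eq, smul_eq_mul, Ring.choose, poch, ← e,
      mul_div_cancel_left₀ _ h0]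
    congr 2
    ring
  rw [hf]
  exact h

/-- The coefficient of `w ^ k` in the Gauss series `₂F₁(m+1,-α;c;w)`. -/
def gaussCoeff (m : ℕ) (c : ℂ) (α : ℝ) (k : ℕ) : ℂ :=
  poch ((m : ℂ) + 1) k * poch (-(α : ℂ)) k / (poch c k * (k.factorial : ℂ))

lemma poch_natCast_add_two_ne_zero (j k : ℕ) : poch ((j : ℂ) + 2) k ≠ 0 :=
  poch_ne_zero fun i _ => by exact_mod_cast (show j + 2 + i ≠ 0 by omega)

lemma hasSum_numer {α : ℝ} (hα : 0 ≤ α) (m n : ℕ) {w : ℂ} (hw : ‖w‖ < 1) :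
    HasSum (fun k => gaussCoeff m (n + m + 2) α k * w ^ (m + n + 1 + k)) (numer m n α w) := by
  have hs : ∀ w : ℂ, ‖w‖ < 1 → 1 - w ∈ Complex.slitPlane := fun w hw => by
    simpa [sub_eq_add_neg] using Complex.mem_slitPlane_of_norm_lt_one (z := -w) (by simpa using hw)
  induction n generalizing w with
  | zero =>
    have hg : ∀ w : ℂ, ‖w‖ < 1 → HasSum
        (fun k => ((m : ℂ) + 1) * (poch (-(α : ℂ)) k / (k.factorial : ℂ)) * w ^ (m + k))
        ((m + 1) * (w ^ m * (1 - w) ^ (α : ℂ))) := by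
      intro w hw
      have := ((hasSum_one_sub_cpow α hw).mul_left (w ^ m)).mul_left ((m : ℂ) + 1)
      have hf : (fun k => ((m : ℂ) + 1) * (poch (-(α : ℂ)) k / (k.factorial : ℂ)) * w ^ (m + k))
          = fun k => ((m : ℂ) + 1) * (w ^ m * (poch (-(α : ℂ)) k / (k.factorial : ℂ) * w ^ k)) := by
        funext k
        rw [pow_add]
        ring
      rw [hf]
      exact this
    have h := hasSum_primitive (fun w hw => hasDerivAt_numer_zero hα m (hs w hw))
      (numer_apply_zero hα m 0) hg hw
    have hf : (fun k => gaussCoeff m ((0 : ℕ) + m + 2) α k * w ^ (m + 0 + 1 + k)) = fun k : ℕ =>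
        ((m : ℂ) + 1) * (poch (-(α : ℂ)) k / (k.factorial : ℂ)) / (m + k + 1) * w ^ (m + 1 + k) := by
      funext k
      have h0 : (k.factorial : ℂ) ≠ 0 := by exact_mod_cast k.factorial_ne_zero
      have h1 : (m : ℂ) + k + 1 ≠ 0 := by exact_mod_cast (m + k).succ_ne_zero
      have h2 := poch_natCast_add_two_ne_zero m k
      have e := mul_poch_add_one ((m : ℂ) + 1) k
      rw [show (m : ℂ) + 1 + 1 = m + 2 by ring] at e
      congr 1
      rw [gaussCoeff, Nat.cast_zero, zero_add]
      field_simp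
      linear_combination (-poch (-(α : ℂ)) k) * e
    rw [hf]
    exact h
  | succ n ih =>
    have hg : ∀ w : ℂ, ‖w‖ < 1 → HasSum
        (fun k => ((n : ℂ) + m + 2) * gaussCoeff m (n + m + 2) α k * w ^ (m + n + 1 + k))
        ((n + m + 2) * numer m n α w) := by
      intro w hw
      simpa only [mul_assoc] using (ih hw).mul_left ((n : ℂ) + m + 2)
    have h := hasSum_primitive (fun w hw => hasDerivAt_numer_succ hα m n (hs w hw))
      (numer_apply_zero hα m (n + 1)) hg hw
    have hf : (fun k => gaussCoeff m ((n + 1 : ℕ) + m + 2) α k * w ^ (m + (n + 1) + 1 + k))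
        = fun k : ℕ => ((n : ℂ) + m + 2) * gaussCoeff m (n + m + 2) α k /
            ((m + n + 1 : ℕ) + k + 1) * w ^ (m + n + 1 + 1 + k) := by
      funext k
      have h0 : (k.factorial : ℂ) ≠ 0 := by exact_mod_cast k.factorial_ne_zero
      have h1 : (((m + n + 1 : ℕ) : ℂ) + k + 1) ≠ 0 := by
        exact_mod_cast (m + n + 1 + k).succ_ne_zero
      have h2 := poch_natCast_add_two_ne_zero (n + m) k
      have h3 := poch_natCast_add_two_ne_zero (n + 1 + m) k
      have e := mul_poch_add_one ((n : ℂ) + m + 2) k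
      rw [show (n : ℂ) + m + 2 + 1 = n + 1 + m + 2 by ring] at e
      rw [show m + (n + 1) + 1 + k = m + n + 1 + 1 + k by omega]
      congr 1
      simp only [gaussCoeff]
      push_cast at *
      field_simp
      linear_combination (-(poch ((m : ℂ) + 1) k * poch (-(α : ℂ)) k)) * e
    rw [hf]
    exact h

lemma ordinaryHypergeometric_eq_tsum_gaussCoeff (m : ℕ) (c : ℂ) (α : ℝ) (w : ℂ) :
    ordinaryHypergeometric ((m : ℂ) + 1) (-(α : ℂ)) c w = ∑' k, gaussCoeff m c α k * w ^ k := by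
  rw [ordinaryHypergeometric_eq_tsum]
  refine tsum_congr fun k => ?_
  rw [smul_eq_mul, gaussCoeff, poch, poch, poch, div_eq_mul_inv, mul_inv]
  ring

lemma numer_eq_pow_mul {α : ℝ} (hα : 0 ≤ α) (m n : ℕ) {w : ℂ} (hw : ‖w‖ < 1) :
    numer m n α w = w ^ (m + n + 1) *
      ordinaryHypergeometric ((m : ℂ) + 1) (-(α : ℂ)) ((n : ℂ) + m + 2) w := by
  rw [ordinaryHypergeometric_eq_tsum_gaussCoeff, ← tsum_mul_left,
    ← (hasSum_numer hα m n hw).tsum_eq]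
  refine tsum_congr fun k => ?_
  rw [pow_add]
  ring

/-! ### Analytic continuation to the slit plane -/

lemma differentiableAt_ordinaryHypergeometric_zero (m n : ℕ) (α : ℝ) :
    DifferentiableAt ℂ (ordinaryHypergeometric ((m : ℂ) + 1) (-(α : ℂ)) ((n : ℂ) + m + 2))
      (0 : ℂ) := by
  have hr : 0 < (ordinaryHypergeometricSeries ℂ ((m : ℂ) + 1) (-(α : ℂ))
      ((n : ℂ) + m + 2)).radius := by
    -- For `α` a natural number the series terminates and the radius is infinite; otherwise it is
    -- `1`.
    by_cases h : ∃ k : ℕ, (k : ℂ) = α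
    · obtain ⟨k, hk⟩ := h
      rw [← hk, ordinaryHypergeometric_radius_top_of_neg_nat₂]
      exact ENNReal.zero_lt_top
    · rw [ordinaryHypergeometricSeries_radius_eq_one]
      · exact one_pos
      · intro k
        refine ⟨fun h' => ?_, fun h' => h ⟨k, by simpa using h'⟩, fun h' => ?_⟩
        · have : ((k + m + 1 : ℕ) : ℂ) = 0 := by
            push_cast
            linear_combination h'
          exact absurd (Nat.cast_eq_zero.1 this) (by omega)
        · have : ((k + n + m + 2 : ℕ) : ℂ) = 0 := by
            push_cast
            linear_combination h'
          exact absurd (Nat.cast_eq_zero.1 this) (by omega)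
  exact (FormalMultilinearSeries.hasFPowerSeriesOnBall _ hr).analyticAt.differentiableAt

lemma mem_slit_iff {w : ℂ} : w ∈ slit ↔ 1 - w ∈ Complex.slitPlane := by
  rw [Complex.mem_slitPlane_iff_not_le_zero, slit, mem_compl_iff, not_iff_not]
  constructor
  · rintro ⟨x, hx, rfl⟩
    have : (1 : ℝ) - x ≤ 0 := by simpa using hx
    exact_mod_cast this
  · intro h
    rw [Complex.le_def] at h
    simp only [Complex.sub_re, Complex.one_re, Complex.zero_re, Complex.sub_im, Complex.one_im,
      Complex.zero_im] at h
    exact ⟨w.re, by simpa using h.1, Complex.ext (by simp) (by simp [show w.im = 0 by simpa using h.2])⟩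

lemma isOpen_slit : IsOpen slit := by
  have : slit = (fun w : ℂ => 1 - w) ⁻¹' Complex.slitPlane := by
    ext w
    exact mem_slit_iff
  rw [this]
  exact Complex.isOpen_slitPlane.preimage (by fun_prop)

lemma isPreconnected_slit : IsPreconnected slit := by
  have : slit = (fun w : ℂ => 1 - w) '' Complex.slitPlane := by
    ext w
    rw [mem_slit_iff]
    constructor
    · intro h
      exact ⟨1 - w, h, by ring⟩
    · rintro ⟨v, hv, rfl⟩
      simpa using hv
  rw [this]
  exact (Complex.starConvex_one_slitPlane.isPathConnected
    Complex.one_mem_slitPlane).isConnected.isPreconnected.image _ (by fun_prop)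

lemma zero_mem_slit : (0 : ℂ) ∈ slit := by
  simp [mem_slit_iff, Complex.one_mem_slitPlane]

lemma IsContinuation.eqOn {a b c : ℂ} {F G : ℂ → ℂ} (hF : IsContinuation a b c F)
    (hG : IsContinuation a b c G) : EqOn F G slit := by
  refine (hF.1.analyticOnNhd isOpen_slit).eqOn_of_preconnected_of_eventuallyEq
    (hG.1.analyticOnNhd isOpen_slit) isPreconnected_slit zero_mem_slit ?_
  filter_upwards [Metric.ball_mem_nhds (0 : ℂ) one_pos] with w hw
  have hw' : ‖w‖ < 1 := by simpa using hw
  rw [hF.2 w hw', hG.2 w hw']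

open Classical in
lemma exists_isContinuation {α : ℝ} (hα : 0 ≤ α) (m n : ℕ) :
    ∃ F, IsContinuation ((m : ℂ) + 1) (-(α : ℂ)) ((n : ℂ) + m + 2) F ∧
      ∀ w, w ≠ 0 → F w = numer m n α w / w ^ (m + n + 1) := by
  -- The quotient takes the default value `0` at `w = 0`, so the value of the series is inserted
  -- there.
  refine ⟨fun w => if w = 0 then
    ordinaryHypergeometric ((m : ℂ) + 1) (-(α : ℂ)) ((n : ℂ) + m + 2) 0
    else numer m n α w / w ^ (m + n + 1), ⟨?_, ?_⟩, fun w hw => if_neg hw⟩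
  · intro w hw
    refine DifferentiableAt.differentiableWithinAt ?_
    by_cases h : w = 0
    · subst h
      refine (differentiableAt_ordinaryHypergeometric_zero m n α).congr_of_eventuallyEq ?_
      filter_upwards [Metric.ball_mem_nhds (0 : ℂ) one_pos] with w hw
      by_cases h : w = 0
      · simp [h]
      · simp only [if_neg h]
        rw [numer_eq_pow_mul hα m n (by simpa using hw),
          mul_div_cancel_left₀ _ (pow_ne_zero _ h)]
    · have hd : DifferentiableAt ℂ (numer m n α) w := by
        cases n with
        | zero => exact (hasDerivAt_numer_zero hα m (mem_slit_iff.1 hw)).differentiableAt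
        | succ n => exact (hasDerivAt_numer_succ hα m n (mem_slit_iff.1 hw)).differentiableAt
      refine (hd.div (differentiableAt_fun_id.pow (m + n + 1))
        (pow_ne_zero _ h)).congr_of_eventuallyEq ?_
      filter_upwards [isOpen_ne.mem_nhds h] with v hv
      exact if_neg hv
  · intro w hw
    by_cases h : w = 0
    · simp [h]
    · simp only [if_neg h]
      rw [numer_eq_pow_mul hα m n hw, mul_div_cancel_left₀ _ (pow_ne_zero _ h)]

lemma isContinuation_hyp {α : ℝ} (hα : 0 ≤ α) (m n : ℕ) :
    IsContinuation ((m : ℂ) + 1) (-(α : ℂ)) ((n : ℂ) + m + 2)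
      (hyp ((m : ℂ) + 1) (-(α : ℂ)) ((n : ℂ) + m + 2)) :=
  Classical.epsilon_spec (let ⟨F, hF, _⟩ := exists_isContinuation hα m n; ⟨F, hF⟩)

lemma hyp_eq_numer_div {α : ℝ} (hα : 0 ≤ α) (m n : ℕ) {w : ℂ} (hw : w ∈ slit) (h0 : w ≠ 0) :
    hyp ((m : ℂ) + 1) (-(α : ℂ)) ((n : ℂ) + m + 2) w = numer m n α w / w ^ (m + n + 1) := by
  obtain ⟨F, hF, hF'⟩ := exists_isContinuation hα m n
  rw [← hF' w h0]
  exact (isContinuation_hyp hα m n).eqOn hF hw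

/-! ### The three-term identity -/

lemma isOpen_cutPlane : IsOpen cutPlane :=
  ((isCompact_Icc.image Complex.continuous_ofReal).isClosed).isOpen_compl

lemma ne_zero_of_mem_cutPlane {z : ℂ} (hz : z ∈ cutPlane) : z ≠ 0 := by
  rintro rfl
  exact hz ⟨0, by simp, by simp⟩

lemma one_sub_ne_zero_of_mem_cutPlane {z : ℂ} (hz : z ∈ cutPlane) : 1 - z ≠ 0 := by
  intro h
  exact hz ⟨1, by simp, by simpa using sub_eq_zero.1 h⟩

lemma inv_mem_slit {z : ℂ} (hz : z ∈ cutPlane) : z⁻¹ ∈ slit := by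
  rintro ⟨x, hx, hxz⟩
  have hx' : (1 : ℝ) ≤ x := hx
  refine hz ⟨x⁻¹, ⟨by positivity, inv_le_one_of_one_le₀ hx'⟩, ?_⟩
  rw [Complex.ofReal_inv, hxz, inv_inv]

lemma zpow_neg_sub_one (x : ℂ) (n : ℕ) : x ^ (-(n : ℤ) - 1) = (x ^ (n + 1))⁻¹ := by
  rw [show -(n : ℤ) - 1 = -((n + 1 : ℕ) : ℤ) by push_cast; ring, zpow_neg, zpow_natCast]

lemma revTermOneSub_inv (n : ℕ) (b : ℂ) (α : ℝ) {z : ℂ} (hz : z ≠ 0) :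
    revTermOneSub n b α z⁻¹ * z ^ n = hypTerm n b (-(n : ℂ) - α) (1 - z) := by
  rw [hypTerm_eq_sum, revTermOneSub, Finset.sum_mul]
  refine Finset.sum_congr rfl fun k hk => ?_
  obtain ⟨j, rfl⟩ := Nat.exists_eq_add_of_le (show k ≤ n by simpa [Nat.lt_succ_iff] using hk)
  rw [Nat.add_sub_cancel_left, pow_add, show 1 - z = (z⁻¹ - 1) * z by field_simp, mul_pow]
  have : (z⁻¹) ^ j * z ^ j = 1 := by rw [← mul_pow, inv_mul_cancel₀ hz, one_pow]
  linear_combination (termCoeff (k + j) b α k * (z⁻¹ - 1) ^ k * z ^ k) * this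

lemma revTerm_inv (m : ℕ) (b : ℂ) (α : ℝ) {z : ℂ} (hz : z ≠ 0) :
    revTerm m b α z⁻¹ * z ^ m = hypTerm m b (-(m : ℂ) - α) z := by
  rw [hypTerm_eq_sum, revTerm, Finset.sum_mul]
  refine Finset.sum_congr rfl fun k hk => ?_
  obtain ⟨j, rfl⟩ := Nat.exists_eq_add_of_le (show k ≤ m by simpa [Nat.lt_succ_iff] using hk)
  rw [Nat.add_sub_cancel_left, pow_add]
  have : (z⁻¹) ^ j * z ^ j = 1 := by rw [← mul_pow, inv_mul_cancel₀ hz, one_pow]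
  linear_combination (termCoeff (k + j) b α k * z ^ k) * this

/-- The three-term identity. -/
lemma leftTerm_eq_add {α : ℝ} (hα : 0 ≤ α) (m n : ℕ) {z : ℂ} (hz : z ∈ cutPlane) :
    leftTerm m n α z = rightTerm₁ m n α z + rightTerm₂ m n α z := by
  have h0 := ne_zero_of_mem_cutPlane hz
  have h1 := one_sub_ne_zero_of_mem_cutPlane hz
  have hs := inv_mem_slit hz
  have hA : (1 - z⁻¹) ^ (α : ℂ) ≠ 0 := by
    rw [Complex.cpow_def_of_ne_zero (Complex.slitPlane_ne_zero (mem_slit_iff.1 hs))]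
    exact Complex.exp_ne_zero _
  -- Since `(1 - z⁻¹) z = -(1 - z)`, the sign `(-1)^(n+1)` in `numer` is absorbed here.
  have e : (1 - z⁻¹) ^ (n + 1) * z ^ (n + 1) = (-1) ^ (n + 1) * (1 - z) ^ (n + 1) := by
    rw [← mul_pow, ← mul_pow]
    congr 1
    field_simp
    ring
  have e' : ((-1 : ℂ) ^ (n + 1)) * (-1) ^ (n + 1) = 1 := by
    rw [← mul_pow]
    simp
  rw [leftTerm, rightTerm₁, rightTerm₂, hyp_eq_numer_div hα m n hs (inv_ne_zero h0),
    ← revTermOneSub_inv n _ α h0, ← revTerm_inv m _ α h0, zpow_neg_sub_one, Complex.cpow_neg,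
    inv_pow, div_inv_eq_mul, numer, ← connCoeff, ← connCoeff]
  have hD : (1 - z) ^ (n + 1) ≠ 0 := pow_ne_zero _ h1
  set A := (1 - z⁻¹) ^ (α : ℂ)
  set D := (1 - z) ^ (n + 1)
  have hX : (-1) ^ (n + 1) * (1 - z⁻¹) ^ (n + 1) * z ^ (n + 1) = D := by
    linear_combination (-1) ^ (n + 1) * e + D * e'
  rw [show m + n + 1 = n + 1 + m by ring, pow_add]
  generalize (1 - z⁻¹) ^ (n + 1) = X at *
  generalize revTerm m (n + 1) α z⁻¹ = Q
  generalize revTermOneSub n (m + 1) α z⁻¹ = P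
  have hz : z ^ (n + 1) * z ^ m = z ^ n * z ^ (m + 1) := by ring
  field_simp
  linear_combination (connCoeff m n α * A * z ^ m * Q) * hX
    + connCoeff n m α * P * hz

/-! ### The differential equation -/

section ODE

variable {m n : ℕ} {α : ℝ} {U : Set ℂ} {u v : ℂ → ℂ}

lemma solvesODE_of_hasDerivAt (hU : IsOpen U) {u₁ u₂ : ℂ → ℂ}
    (h₁ : ∀ z ∈ U, HasDerivAt u (u₁ z) z) (h₂ : ∀ z ∈ U, HasDerivAt u₁ (u₂ z) z)
    (h : ∀ z ∈ U, z * (1 - z) * u₂ z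
      - (((n : ℂ) + 2) * z + m * (1 - z) + α) * u₁ z + m * ((n : ℂ) + 1) * u z = 0) :
    SolvesODE m n α U u := by
  refine ⟨fun z hz => (h₁ z hz).differentiableAt.differentiableWithinAt, fun z hz => ?_⟩
  have he : deriv u =ᶠ[𝓝 z] u₁ := by
    filter_upwards [hU.mem_nhds hz] with y hy using (h₁ y hy).deriv
  rw [he.deriv_eq, (h₂ z hz).deriv, (h₁ z hz).deriv]
  exact h z hz

lemma SolvesODE.congr (hU : IsOpen U) (hu : SolvesODE m n α U u) (h : EqOn v u U) :
    SolvesODE m n α U v := by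
  refine ⟨hu.1.congr h, fun z hz => ?_⟩
  have he : v =ᶠ[𝓝 z] u := h.eventuallyEq_of_mem (hU.mem_nhds hz)
  rw [he.deriv.deriv_eq, he.deriv_eq, h hz]
  exact hu.2 z hz

lemma SolvesODE.add (hU : IsOpen U) (hu : SolvesODE m n α U u) (hv : SolvesODE m n α U v) :
    SolvesODE m n α U (fun z => u z + v z) := by
  have hd {w : ℂ → ℂ} (hw : DifferentiableOn ℂ w U) {z : ℂ} (hz : z ∈ U) :
      HasDerivAt w (deriv w z) z := (hw.differentiableAt (hU.mem_nhds hz)).hasDerivAt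
  refine solvesODE_of_hasDerivAt hU (fun z hz => (hd hu.1 hz).fun_add (hd hv.1 hz))
    (fun z hz => (hd (hu.1.deriv hU) hz).fun_add (hd (hv.1.deriv hU) hz)) fun z hz => ?_
  linear_combination hu.2 z hz + hv.2 z hz

lemma SolvesODE.const_mul (hU : IsOpen U) (hu : SolvesODE m n α U u) (c : ℂ) :
    SolvesODE m n α U (fun z => c * u z) := by
  have hd {w : ℂ → ℂ} (hw : DifferentiableOn ℂ w U) {z : ℂ} (hz : z ∈ U) :
      HasDerivAt w (deriv w z) z := (hw.differentiableAt (hU.mem_nhds hz)).hasDerivAt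
  refine solvesODE_of_hasDerivAt hU (fun z hz => (hd hu.1 hz).const_mul c)
    (fun z hz => (hd (hu.1.deriv hU) hz).const_mul c) fun z hz => ?_
  linear_combination c * hu.2 z hz

end ODE

/-- The derivative of the terminating series `₂F₁(-N,b;-N-α;z)`. -/
def hypTermDeriv (N : ℕ) (b : ℂ) (α : ℝ) (z : ℂ) : ℂ :=
  ∑ k ∈ Finset.range (N + 1), termCoeff N b α k * (k * z ^ (k - 1))

/-- The second derivative of the terminating series `₂F₁(-N,b;-N-α;z)`. -/
def hypTermDeriv₂ (N : ℕ) (b : ℂ) (α : ℝ) (z : ℂ) : ℂ :=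
  ∑ k ∈ Finset.range (N + 1), termCoeff N b α k * (k * (((k - 1 : ℕ) : ℂ) * z ^ (k - 1 - 1)))

lemma hasDerivAt_hypTerm (N : ℕ) (b : ℂ) (α : ℝ) (z : ℂ) :
    HasDerivAt (hypTerm N b (-(N : ℂ) - α)) (hypTermDeriv N b α z) z :=
  HasDerivAt.fun_sum fun _ _ => (hasDerivAt_pow _ _).const_mul _

lemma hasDerivAt_hypTermDeriv (N : ℕ) (b : ℂ) (α : ℝ) (z : ℂ) :
    HasDerivAt (hypTermDeriv N b α) (hypTermDeriv₂ N b α z) z :=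
  HasDerivAt.fun_sum fun _ _ => ((hasDerivAt_pow _ _).const_mul _).const_mul _

lemma hypTerm_ode {α : ℝ} (hα : 0 ≤ α) (N : ℕ) (b z : ℂ) :
    z * (1 - z) * hypTermDeriv₂ N b α z + (-(N : ℂ) - α - (-N + b + 1) * z) * hypTermDeriv N b α z
      + N * b * hypTerm N b (-(N : ℂ) - α) z = 0 := by
  have h : z * (1 - z) * hypTermDeriv₂ N b α z
      + (-(N : ℂ) - α - (-N + b + 1) * z) * hypTermDeriv N b α z
      + N * b * hypTerm N b (-(N : ℂ) - α) z
      = ∑ k ∈ Finset.range (N + 1),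
          termCoeff N b α k * (k * (k - 1 - N - α)) * z ^ (k - 1)
        + ∑ k ∈ Finset.range (N + 1), termCoeff N b α k * ((N - k) * (b + k)) * z ^ k := by
    rw [hypTerm_eq_sum, hypTermDeriv, hypTermDeriv₂, Finset.mul_sum, Finset.mul_sum,
      Finset.mul_sum, ← Finset.sum_add_distrib, ← Finset.sum_add_distrib,
      ← Finset.sum_add_distrib]
    refine Finset.sum_congr rfl fun k _ => ?_
    -- The exponents `k - 1` and `k - 1 - 1` truncate at `k = 0` and `k = 1`, where the coefficients
    -- vanish.
    rcases k with _ | _ | k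
    · simp
      ring
    · simp
      ring
    · simp only [Nat.add_sub_cancel]
      push_cast
      ring
  -- The first sum loses its term `k = 0` and the second its term `k = N`, both zero; the shifted
  -- sums cancel by the recurrence.
  rw [h, Finset.sum_range_succ', Finset.sum_range_succ, sub_self]
  simp only [Nat.cast_zero, zero_mul, mul_zero, add_zero]
  rw [← Finset.sum_add_distrib]
  refine Finset.sum_eq_zero fun k _ => ?_
  rw [Nat.add_sub_cancel]
  push_cast
  linear_combination (-z ^ k) * termCoeff_succ hα N b k

lemma solvesODE_rightTerm₂ {α : ℝ} (hα : 0 ≤ α) (m n : ℕ) :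
    SolvesODE m n α cutPlane (rightTerm₂ m n α) := by
  refine SolvesODE.const_mul isOpen_cutPlane (u := hypTerm m ((n : ℂ) + 1) (-(m : ℂ) - α)) ?_ _
  refine solvesODE_of_hasDerivAt isOpen_cutPlane (fun z _ => hasDerivAt_hypTerm m _ α z)
    (fun z _ => hasDerivAt_hypTermDeriv m _ α z) fun z _ => ?_
  linear_combination hypTerm_ode hα m (n + 1) z

/-- The factor `z^{m+1} (1-z)^{-n-1} (1-z⁻¹)^{-α}`. -/
def prefactor (m n : ℕ) (α : ℝ) (z : ℂ) : ℂ :=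
  z ^ (m + 1) * (1 - z) ^ (-(n : ℤ) - 1) * (1 - z⁻¹) ^ (-(α : ℂ))

lemma hasDerivAt_one_sub (z : ℂ) : HasDerivAt (fun z : ℂ => 1 - z) (-1) z := by
  simpa using (hasDerivAt_id z).const_sub 1

/-- The quotient is the logarithmic derivative `(m+1)/z + (n+1)/(1-z) + α/(z(1-z))`. -/
lemma hasDerivAt_prefactor (m n : ℕ) (α : ℝ) {z : ℂ} (hz : z ∈ cutPlane) :
    HasDerivAt (prefactor m n α) (prefactor m n α z *
      (((m + 1) * (1 - z) + (n + 1) * z + α) / (z * (1 - z)))) z := by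
  have h0 := ne_zero_of_mem_cutPlane hz
  have h1 := one_sub_ne_zero_of_mem_cutPlane hz
  have hs := mem_slit_iff.1 (inv_mem_slit hz)
  have hs0 := Complex.slitPlane_ne_zero hs
  have d1 := hasDerivAt_pow (m + 1) z
  have d2 := (hasDerivAt_zpow (-(n : ℤ) - 1) (1 - z) (Or.inl h1)).comp z (hasDerivAt_one_sub z)
  have d3 := ((hasDerivAt_inv h0).const_sub 1).cpow_const (c := -(α : ℂ)) hs
  refine ((d1.fun_mul d2).fun_mul d3).congr_deriv ?_
  have e2 : (1 - z) ^ (-(n : ℤ) - 1 - 1) = (1 - z) ^ (-(n : ℤ) - 1) / (1 - z) := by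
    rw [zpow_sub_one₀ h1 (-(n : ℤ) - 1), div_eq_mul_inv]
  have e3 : (1 - z⁻¹) ^ (-(α : ℂ) - 1) = (1 - z⁻¹) ^ (-(α : ℂ)) * (z / (z - 1)) := by
    rw [Complex.cpow_sub _ _ hs0, Complex.cpow_one, div_eq_mul_inv]
    congr 1
    rw [← one_div, ← one_div]
    have : z - 1 ≠ 0 := fun h => h1 (by linear_combination -h)
    field_simp
  have h1' : z - 1 ≠ 0 := fun h => h1 (by linear_combination -h)
  simp only [Function.comp_apply, e2, e3, prefactor, Nat.add_sub_cancel]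
  generalize (1 - z⁻¹) ^ (-(α : ℂ)) = A
  generalize (1 - z) ^ (-(n : ℤ) - 1) = B
  rw [show z - 1 = -(1 - z) by ring, pow_succ]
  push_cast
  field_simp
  ring

/-- Dividing out `prefactor` turns the equation into the hypergeometric equation with parameters
`(-n, m+1; -n-α)` in the variable `1-z`, which the polynomial factor satisfies. -/
lemma solvesODE_rightTerm₁ {α : ℝ} (hα : 0 ≤ α) (m n : ℕ) :
    SolvesODE m n α cutPlane (rightTerm₁ m n α) := by
  have hc : SolvesODE m n α cutPlane
      (fun z => prefactor m n α z * hypTerm n ((m : ℂ) + 1) (-(n : ℂ) - α) (1 - z)) := by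
    have dv (z : ℂ) : HasDerivAt (fun z => hypTerm n ((m : ℂ) + 1) (-(n : ℂ) - α) (1 - z))
        (hypTermDeriv n (m + 1) α (1 - z) * -1) z :=
      (hasDerivAt_hypTerm n (m + 1) α (1 - z)).comp z (hasDerivAt_one_sub z)
    have dv' (z : ℂ) : HasDerivAt (fun z => hypTermDeriv n (m + 1) α (1 - z) * -1)
        (hypTermDeriv₂ n (m + 1) α (1 - z) * -1 * -1) z :=
      ((hasDerivAt_hypTermDeriv n (m + 1) α (1 - z)).comp z (hasDerivAt_one_sub z)).mul_const _
    have dq {z : ℂ} (hz : z ∈ cutPlane) : HasDerivAt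
        (fun z : ℂ => ((m + 1) * (1 - z) + (n + 1) * z + α) / (z * (1 - z)))
        ((((n : ℂ) - m) * (z * (1 - z)) - ((m + 1) * (1 - z) + (n + 1) * z + α) * (1 - 2 * z))
          / (z * (1 - z)) ^ 2) z := by
      have h0 := ne_zero_of_mem_cutPlane hz
      have h1 := one_sub_ne_zero_of_mem_cutPlane hz
      refine (((((hasDerivAt_one_sub z).const_mul ((m : ℂ) + 1)).fun_add
        ((hasDerivAt_id' z).const_mul ((n : ℂ) + 1))).add_const (α : ℂ)).fun_div
        ((hasDerivAt_id' z).fun_mul (hasDerivAt_one_sub z)) (mul_ne_zero h0 h1)).congr_deriv ?_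
      congr 1
      ring
    refine solvesODE_of_hasDerivAt isOpen_cutPlane
      (fun z hz => (hasDerivAt_prefactor m n α hz).fun_mul (dv z))
      (fun z hz => (((hasDerivAt_prefactor m n α hz).fun_mul (dq hz)).fun_mul (dv z)).fun_add
        ((hasDerivAt_prefactor m n α hz).fun_mul (dv' z))) fun z hz => ?_
    have h0 := ne_zero_of_mem_cutPlane hz
    have h1 := one_sub_ne_zero_of_mem_cutPlane hz
    have ho := hypTerm_ode hα n (m + 1) (1 - z)
    generalize hypTermDeriv₂ n (m + 1) α (1 - z) = v₂ at *
    generalize hypTermDeriv n (m + 1) α (1 - z) = v₁ at *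
    generalize hypTerm n (m + 1) (-(n : ℂ) - α) (1 - z) = v₀ at *
    generalize prefactor m n α z = h
    field_simp
    linear_combination (h * z * (1 - z)) * ho
  refine (hc.const_mul isOpen_cutPlane
    (poch ((n : ℂ) + 1) (m + 1) / poch ((n : ℂ) + α + 1) (m + 1))).congr isOpen_cutPlane
    fun z _ => ?_
  simp only [rightTerm₁, prefactor]
  ring

lemma solvesODE_leftTerm {α : ℝ} (hα : 0 ≤ α) (m n : ℕ) :
    SolvesODE m n α cutPlane (leftTerm m n α) :=
  ((solvesODE_rightTerm₁ hα m n).add isOpen_cutPlane (solvesODE_rightTerm₂ hα m n)).congr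
    isOpen_cutPlane fun _ hz => leftTerm_eq_add hα m n hz

/-! ### The identity at `α = 0` -/

lemma hyp_neg_zero (m n : ℕ) {w : ℂ} (hw : w ∈ slit) :
    hyp ((m : ℂ) + 1) (-((0 : ℝ) : ℂ)) ((n : ℂ) + m + 2) w = 1 := by
  refine (isContinuation_hyp le_rfl m n).eqOn (G := fun _ => 1)
    ⟨differentiableOn_const _, fun w _ => ?_⟩ hw
  rw [ordinaryHypergeometric_eq_tsum_gaussCoeff, tsum_eq_single 0]
  · simp [gaussCoeff, poch_zero]
  · intro k hk
    have : poch 0 k = 0 := by simp [poch, hk]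
    simp [gaussCoeff, this]

lemma leftTerm_zero (m n : ℕ) {z : ℂ} (hz : z ∈ cutPlane) :
    leftTerm m n 0 z = leftTerm₀ n z := by
  rw [leftTerm, hyp_neg_zero m n (inv_mem_slit hz), leftTerm₀]
  simp

/-- For `k ≤ N` the symbols `(-N)_k` cancel; beyond `N` they are zero, hence the restriction. -/
lemma termCoeff_zero_right {N k : ℕ} (hk : k ≤ N) (b : ℂ) :
    termCoeff N b 0 k = poch b k / (k.factorial : ℂ) := by
  have h := poch_neg_sub_ne_zero le_rfl hk
  rw [termCoeff]
  simp only [Complex.ofReal_zero, sub_zero] at *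
  exact mul_div_mul_left _ _ h

lemma connCoeff_zero_right (n m : ℕ) : connCoeff n m 0 = 1 := by
  have h := poch_add_one_ne_zero le_rfl n (m + 1)
  rw [connCoeff]
  simp only [Complex.ofReal_zero, add_zero] at *
  exact div_self h

lemma rightTerm₁_zero (m n : ℕ) {z : ℂ} (hz : z ∈ cutPlane) :
    rightTerm₁ m n 0 z = rightTerm₁₀ m n z := by
  have h1 := one_sub_ne_zero_of_mem_cutPlane hz
  rw [rightTerm₁, rightTerm₁₀, hypTerm_eq_sum, ← connCoeff, connCoeff_zero_right]
  simp only [Complex.ofReal_zero, neg_zero, Complex.cpow_zero, one_mul, mul_one]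
  rw [mul_assoc, Finset.mul_sum]
  congr 1
  refine Finset.sum_congr rfl fun k hk => ?_
  rw [termCoeff_zero_right (by simpa [Nat.lt_succ_iff] using hk),
    show (k : ℤ) - n - 1 = (-(n : ℤ) - 1) + k by ring, zpow_add₀ h1, zpow_natCast]
  ring

lemma rightTerm₂_zero (m n : ℕ) (z : ℂ) : rightTerm₂ m n 0 z = rightTerm₂₀ m n z := by
  rw [rightTerm₂, rightTerm₂₀, hypTerm_eq_sum, ← connCoeff, connCoeff_zero_right, one_mul]
  refine Finset.sum_congr rfl fun k hk => ?_
  rw [termCoeff_zero_right (by simpa [Nat.lt_succ_iff] using hk)]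

lemma leftTerm₀_eq_add_of_mem_cutPlane (m n : ℕ) {z : ℂ} (hz : z ∈ cutPlane) :
    leftTerm₀ n z = rightTerm₂₀ m n z + rightTerm₁₀ m n z := by
  rw [← leftTerm_zero m n hz, leftTerm_eq_add le_rfl m n hz, rightTerm₁_zero m n hz,
    rightTerm₂_zero, add_comm]

lemma leftTerm₀_eq_add (m n : ℕ) {x : ℂ} (hx : x ≠ 1) :
    leftTerm₀ n x = rightTerm₂₀ m n x + rightTerm₁₀ m n x := by
  by_cases hc : x ∈ cutPlane
  · exact leftTerm₀_eq_add_of_mem_cutPlane m n hc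
  obtain ⟨r, -, rfl⟩ := not_not.1 hc
  have h1 : 1 - (r : ℂ) ≠ 0 := sub_ne_zero.2 hx.symm
  have hz (j : ℤ) : ContinuousAt (fun z : ℂ => (1 - z) ^ j) r :=
    (continuousAt_const.sub continuousAt_id).zpow₀ j (Or.inl h1)
  have hl : ContinuousAt (leftTerm₀ n) r := hz _
  have hr : ContinuousAt (fun z => rightTerm₂₀ m n z + rightTerm₁₀ m n z) r := by
    refine ContinuousAt.add ?_ (ContinuousAt.mul (by fun_prop) ?_)
    · exact Continuous.continuousAt (by unfold rightTerm₂₀; fun_prop)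
    · exact tendsto_finsetSum _ fun k _ => (hz _).const_mul _
  -- A point `r ≠ 1` of the cut is approached along a vertical line, which lies in the cut plane for
  -- `t ≠ 0`.
  have hp : Tendsto (fun t : ℝ => (r : ℂ) + t * Complex.I) (𝓝[≠] 0) (𝓝 r) := by
    refine tendsto_nhdsWithin_of_tendsto_nhds ?_
    have : Continuous fun t : ℝ => (r : ℂ) + t * Complex.I := by fun_prop
    simpa using this.tendsto 0
  refine tendsto_nhds_unique (hl.tendsto.comp hp) ((hr.tendsto.comp hp).congr' ?_)
  filter_upwards [self_mem_nhdsWithin] with t ht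
  refine (leftTerm₀_eq_add_of_mem_cutPlane m n ?_).symm
  rintro ⟨y, -, hy⟩
  have := congrArg Complex.im hy
  simp only [Complex.ofReal_im, Complex.add_im, Complex.mul_im, Complex.ofReal_re, Complex.I_im,
    Complex.I_re, mul_one, mul_zero, add_zero, zero_add] at this
  exact ht this.symm

/-! ### The limit as `α` tends to `0` -/

lemma continuous_poch {f : ℝ → ℂ} (hf : Continuous f) (k : ℕ) :
    Continuous fun t => poch (f t) k :=
  (ascPochhammer ℂ k).continuous.comp hf

lemma continuousAt_connCoeff (n m : ℕ) : ContinuousAt (fun α : ℝ => connCoeff n m α) 0 :=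
  continuousAt_const.div (continuous_poch (by fun_prop) _).continuousAt
    (poch_add_one_ne_zero le_rfl n (m + 1))

lemma continuousAt_hypTerm (N : ℕ) (b z : ℂ) :
    ContinuousAt (fun α : ℝ => hypTerm N b (-(N : ℂ) - α) z) 0 := by
  refine tendsto_finsetSum _ fun k hk => ContinuousAt.mul (ContinuousAt.div continuousAt_const
    ((continuous_poch (by fun_prop) _).continuousAt.mul continuousAt_const) ?_) continuousAt_const
  exact mul_ne_zero (poch_neg_sub_ne_zero le_rfl (by simpa [Nat.lt_succ_iff] using hk))
    (by exact_mod_cast k.factorial_ne_zero)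

lemma tendsto_rightTerm₁ (m n : ℕ) {z : ℂ} (hz : z ∈ cutPlane) :
    Tendsto (fun α : ℝ => rightTerm₁ m n α z) (𝓝 0) (𝓝 (rightTerm₁₀ m n z)) := by
  rw [← rightTerm₁_zero m n hz]
  have hs0 := Complex.slitPlane_ne_zero (mem_slit_iff.1 (inv_mem_slit hz))
  have hp : ContinuousAt (fun α : ℝ => (1 - z⁻¹) ^ (-(α : ℂ))) 0 :=
    ContinuousAt.const_cpow (by fun_prop) (Or.inl hs0)
  exact ((((continuousAt_connCoeff n m).mul continuousAt_const).mul continuousAt_const).mul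
    hp).mul (continuousAt_hypTerm n _ _)

lemma tendsto_rightTerm₂ (m n : ℕ) (z : ℂ) :
    Tendsto (fun α : ℝ => rightTerm₂ m n α z) (𝓝 0) (𝓝 (rightTerm₂₀ m n z)) := by
  rw [← rightTerm₂_zero m n]
  exact (continuousAt_connCoeff m n).mul (continuousAt_hypTerm m _ _)

/-- The identity transfers the limits of the right-hand terms, so continuity of the continued
function in `α` is not needed. -/
lemma tendsto_leftTerm (m n : ℕ) {z : ℂ} (hz : z ∈ cutPlane) :
    Tendsto (fun α : ℝ => leftTerm m n α z) (𝓝[>] 0) (𝓝 (leftTerm₀ n z)) := by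
  rw [leftTerm₀_eq_add_of_mem_cutPlane m n hz, add_comm]
  refine (tendsto_nhdsWithin_of_tendsto_nhds
    ((tendsto_rightTerm₁ m n hz).add (tendsto_rightTerm₂ m n z))).congr' ?_
  filter_upwards [self_mem_nhdsWithin] with α hα
  exact (leftTerm_eq_add (le_of_lt hα) m n hz).symm

end

end ChaundyBullard

theorem mainTheorem5 (m n : ℕ) :
    -- for every `α > 0`:
    (∀ α : ℝ, 0 < α →
      -- the analytic continuation of `₂F₁(m+1,-α;n+m+2;·)` to `ℂ ∖ [1,∞)` exists and is unique
      (IsContinuation ((m : ℂ) + 1) (-(α : ℂ)) ((n : ℂ) + m + 2)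
          (hyp ((m : ℂ) + 1) (-(α : ℂ)) ((n : ℂ) + m + 2)) ∧
        ∀ F : ℂ → ℂ, IsContinuation ((m : ℂ) + 1) (-(α : ℂ)) ((n : ℂ) + m + 2) F →
          Set.EqOn F (hyp ((m : ℂ) + 1) (-(α : ℂ)) ((n : ℂ) + m + 2)) slit) ∧
      -- the three-term identity
      (∀ z ∈ cutPlane,
        (1 - z) ^ (-(n : ℤ) - 1) * (1 - z⁻¹) ^ (-(α : ℂ)) *
            hyp ((m : ℂ) + 1) (-(α : ℂ)) ((n : ℂ) + m + 2) z⁻¹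
          = poch ((n : ℂ) + 1) (m + 1) / poch ((n : ℂ) + α + 1) (m + 1) *
              z ^ (m + 1) * (1 - z) ^ (-(n : ℤ) - 1) * (1 - z⁻¹) ^ (-(α : ℂ)) *
              hypTerm n ((m : ℂ) + 1) (-(n : ℂ) - α) (1 - z)
            + poch ((m : ℂ) + 1) (n + 1) / poch ((m : ℂ) + α + 1) (n + 1) *
              hypTerm m ((n : ℂ) + 1) (-(m : ℂ) - α) z) ∧
      -- its three terms solve the same hypergeometric differential equation
      SolvesODE m n α cutPlane (leftTerm m n α) ∧
      SolvesODE m n α cutPlane (rightTerm₁ m n α) ∧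
      SolvesODE m n α cutPlane (rightTerm₂ m n α)) ∧
    -- as `α ↓ 0`, each of the three terms tends to the corresponding term of the limit identity
    (∀ z ∈ cutPlane,
      Filter.Tendsto (fun α : ℝ => leftTerm m n α z) (nhdsWithin 0 (Set.Ioi 0))
        (nhds (leftTerm₀ n z)) ∧
      Filter.Tendsto (fun α : ℝ => rightTerm₁ m n α z) (nhdsWithin 0 (Set.Ioi 0))
        (nhds (rightTerm₁₀ m n z)) ∧
      Filter.Tendsto (fun α : ℝ => rightTerm₂ m n α z) (nhdsWithin 0 (Set.Ioi 0))
        (nhds (rightTerm₂₀ m n z))) ∧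
    -- the limit identity
    (∀ x : ℂ, x ≠ 1 →
      (1 - x) ^ (-(n : ℤ) - 1)
        = ∑ k ∈ Finset.range (m + 1), poch ((n : ℂ) + 1) k / (k.factorial : ℂ) * x ^ k
          + x ^ (m + 1) * ∑ k ∈ Finset.range (n + 1),
              poch ((m : ℂ) + 1) k / (k.factorial : ℂ) * (1 - x) ^ ((k : ℤ) - n - 1)) ∧
    -- the three limit terms solve the limit `α = 0` of the differential equation
    SolvesODE m n 0 cutPlane (leftTerm₀ n) ∧
    SolvesODE m n 0 cutPlane (rightTerm₁₀ m n) ∧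
    SolvesODE m n 0 cutPlane (rightTerm₂₀ m n) := by
  refine ⟨fun α hα => ⟨⟨isContinuation_hyp hα.le m n,
      fun F hF => hF.eqOn (isContinuation_hyp hα.le m n)⟩,
      fun z hz => leftTerm_eq_add hα.le m n hz, solvesODE_leftTerm hα.le m n,
      solvesODE_rightTerm₁ hα.le m n, solvesODE_rightTerm₂ hα.le m n⟩,
    fun z hz => ⟨tendsto_leftTerm m n hz,
      tendsto_nhdsWithin_of_tendsto_nhds (tendsto_rightTerm₁ m n hz),
      tendsto_nhdsWithin_of_tendsto_nhds (tendsto_rightTerm₂ m n z)⟩,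
    fun x hx => leftTerm₀_eq_add m n hx, ?_, ?_, ?_⟩
  · exact (solvesODE_leftTerm le_rfl m n).congr isOpen_cutPlane
      fun z hz => (leftTerm_zero m n hz).symm
  · exact (solvesODE_rightTerm₁ le_rfl m n).congr isOpen_cutPlane
      fun z hz => (rightTerm₁_zero m n hz).symm
  · exact (solvesODE_rightTerm₂ le_rfl m n).congr isOpen_cutPlane
      fun z _ => (rightTerm₂_zero m n z).symm
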